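/- **Definitions.** A *bigraph* $B=(G,H)$ is a pair of finite undirected graphs $G=(V,\mathcal E)$, $H=(W,\mathcal E)$ with the same edge set $\mathcal E$ (the *biedges*), where several components, multiple edges and self-loops are allowed, and where total orders $\prec$ on $V$ and $W$ are fixed. Let $L_G\subseteq\mathbb C^V$ be the span of the vectors $x$ such that $x_u=x_t$ if and only if $u$ and $t$ are in the same connected component of $G$, and define $L_H\subseteq\mathbb C^W$ likewise. The rational map associated to $B$ is $$f_B\colon\ \mathbb P(\mathbb C^V/L_G)\times\mathbb P(\mathbb C^W/L_H)\dashrightarrow\mathbb P(\mathbb C^{\mathcal E}),\qquad ([x],[y])\longmapsto\bigl((x_u-x_v)(y_t-y_w)\bigr)_{e\in\mathcal E},$$ where $u\prec v$ are the endpoints of $e$ in $G$ and $t\prec w$ are the endpoints of $e$ in $H$ (a factor belonging to a self-loop is $0$). The *Laman number* $\operatorname{Lam}(B)\in\mathbb N\cup\{\infty\}$ is $0$ if $f_B$ is not dominant; otherwise it is the degree of $f_B$, that is, the number (possibly $\infty$) of points of the fibre of $f_B$ over a general point of $\mathbb P(\mathbb C^{\mathcal E})$. An edge is a *bridge* of a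 graph if removing it, while keeping all vertices, increases the number of connected components. A bigraph $B=(G,H)$ without self-loops *untangles* via $\bar e\in\mathcal E$ if $G$ is the disjoint union of two subgraphs $G_1',G_2'$ with no edges between them, $H$ is the disjoint union of two subgraphs $H_1',H_2'$ with no edges between them, and $\mathcal E=\mathcal E_1\cup\mathcal E_2\cup\{\bar e\}$ is a partition such that $$G_1'=(V_1',\mathcal E_1\cup\{\bar e\}),\quad G_2'=(V_2',\mathcal E_2),\quad H_1'=(W_1',\mathcal E_1),\quad H_2'=(W_2',\mathcal E_2\cup\{\bar e\}).$$ It then untangles *into* the bigraphs $B_1=(G_1'\setminus\{\bar e\},\,H_1')$ with biedges $\mathcal E_1$ and $B_2=(G_2',\,H_2'\setminus\{\bar e\})$ with biedges $\mathcal E_2$, with the induced vertex orders, where $\setminus\{\bar e\}$ means removing the edge $\bar e$ and then keeping only the vertices that are endpoints of a remaining edge. **Proposition.** Suppose that a bigraph $B=(G,H)$ without self-loops untangles via a biedge $\bar e$ into bigraphs $B_1$ and $B_2$, where $\bar e$ is a bridge neither in $G$ nor in $H$. Then $$\operatorname{Lam}(B)=\operatorname{Lam}(B_1)\cdot\operatorname{Lam}(B_2),$$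 with the convention $0\cdot\infty=0$. -/

import Mathlib

open scoped LinearAlgebra.Projectivization

/-- An undirected graph with vertex set `V` and edge set `E`, multiple edges, self-loops and
several components being allowed: `ends e` is the unordered pair of endpoints of `e`. -/
structure Multigraph (V E : Type*) where
  ends : E → Sym2 V

namespace Multigraph

variable {V E : Type*} (G : Multigraph V E)

/-- The simple graph on `V` in which distinct vertices are adjacent iff some edge of `F` joins
them. It has the same connected components as the graph `(V, F)`. -/
def skeleton (F : Set E) : SimpleGraph V := SimpleGraph.fromEdgeSet (G.ends '' F)

/-- `u` and `v` lie in the same connected component of `G`. -/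
def SameComponent (u v : V) : Prop := (G.skeleton Set.univ).Reachable u v

/-- The number of connected components of `(V, F)`. -/
noncomputable def numComponents (F : Set E) : ℕ := Nat.card (G.skeleton F).ConnectedComponent

/-- `e` is a bridge: removing it (and keeping all vertices) increases the number of connected
components. -/
def IsBridge (e : E) : Prop := G.numComponents Set.univ < G.numComponents {e}ᶜ

def NoSelfLoops : Prop := ∀ e, ¬ (G.ends e).IsDiag

/-- The subgraph with vertex set `A` and edge set `F`. -/
def subgraph (A : Set V) (F : Set E) (h : ∀ e ∈ F, ∀ v ∈ G.ends e, v ∈ A) : Multigraph A F where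
  ends e := (G.ends e).attachWith (P := fun v => v ∈ A) (h e e.2)

/-- The set of endpoints of the edges in `F`. -/
def endpoints (F : Set E) : Set V := {v | ∃ e ∈ F, v ∈ G.ends e}

/-- The subgraph with edge set `F` and vertices the endpoints of the edges in `F`. This is what
remains of a subgraph with edge set `F ∪ F'` (`F`, `F'` disjoint) when the edges in `F'`, and
then all isolated vertices, are removed. -/
def spanned (F : Set E) : Multigraph (G.endpoints F) F :=
  G.subgraph (G.endpoints F) F fun e he _ hv => ⟨e, he, hv⟩

/-- The space `L_G` spanned by the vectors `x ∈ ℂ^V` such that `x_u = x_t` if and only if `u` and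
`t` are in the same connected component of `G`. -/
def L : Submodule ℂ (V → ℂ) :=
  Submodule.span ℂ {x | ∀ u t, x u = x t ↔ G.SameComponent u t}

theorem sameComponent_of_ends {e : E} {u v : V} (h : G.ends e = s(u, v)) :
    G.SameComponent u v := by
  by_cases huv : u = v
  · subst huv
    exact SimpleGraph.Reachable.refl _
  · refine SimpleGraph.Adj.reachable ?_
    rw [skeleton, SimpleGraph.fromEdgeSet_adj]
    exact ⟨⟨e, trivial, h⟩, huv⟩

theorem sameComponent_inf_sup [LinearOrder V] (e : E) :
    G.SameComponent (G.ends e).inf (G.ends e).sup := by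
  obtain ⟨u, v, h⟩ : ∃ u v, G.ends e = s(u, v) := by
    induction hs : G.ends e with
    | h u v => exact ⟨u, v, rfl⟩
  rw [h, Sym2.inf_mk, Sym2.sup_mk]
  rcases le_total u v with huv | huv
  · rw [inf_eq_left.2 huv, sup_eq_right.2 huv]
    exact G.sameComponent_of_ends h
  · rw [inf_eq_right.2 huv, sup_eq_left.2 huv]
    exact G.sameComponent_of_ends (h.trans Sym2.eq_swap)

theorem L_le_ker [LinearOrder V] (e : E) :
    G.L ≤ LinearMap.ker
      (LinearMap.proj (φ := fun _ : V => ℂ) (R := ℂ) (G.ends e).inf -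
        LinearMap.proj (φ := fun _ : V => ℂ) (R := ℂ) (G.ends e).sup) := by
  rw [L, Submodule.span_le]
  intro x hx
  have := (hx _ _).2 (G.sameComponent_inf_sup e)
  simp [this]

/-- The linear form `x ↦ x_u - x_v` on `ℂ^V / L_G`, where `u ≺ v` are the endpoints of `e`
(it is zero if `e` is a self-loop). -/
noncomputable def edgeDiff [LinearOrder V] (e : E) : ((V → ℂ) ⧸ G.L) →ₗ[ℂ] ℂ :=
  G.L.liftQ
    (LinearMap.proj (φ := fun _ : V => ℂ) (R := ℂ) (G.ends e).inf -
      LinearMap.proj (φ := fun _ : V => ℂ) (R := ℂ) (G.ends e).sup) (G.L_le_ker e)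

/-- The projective space `ℙ(ℂ^V / L_G)`, of dimension `dim G - 1`. -/
abbrev Space : Type _ := ℙ ℂ ((V → ℂ) ⧸ G.L)

end Multigraph

/-- A subset of a projective space is Zariski closed if it is the common zero locus of a set of
homogeneous polynomials. -/
def IsZariskiClosed {σ : Type*} (Z : Set (ℙ ℂ (σ → ℂ))) : Prop :=
  ∃ I : Set (MvPolynomial σ ℂ), (∀ g ∈ I, ∃ d, g.IsHomogeneous d) ∧
    ∀ (z : σ → ℂ) (hz : z ≠ 0),
      Projectivization.mk ℂ z hz ∈ Z ↔ ∀ g ∈ I, MvPolynomial.eval z g = 0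

def IsZariskiOpen {σ : Type*} (U : Set (ℙ ℂ (σ → ℂ))) : Prop := IsZariskiClosed Uᶜ

def IsZariskiDense {σ : Type*} (S : Set (ℙ ℂ (σ → ℂ))) : Prop :=
  ∀ U : Set (ℙ ℂ (σ → ℂ)), IsZariskiOpen U → U.Nonempty → (S ∩ U).Nonempty

/-- A bigraph: two graphs, with vertex sets `V` and `W`, that have the same edge set `E`, the set
of biedges. (The vertex sets will be finite and totally ordered, and `E` finite.) -/
structure Bigraph (V W E : Type*) where
  G : Multigraph V E
  H : Multigraph W E

namespace Bigraph

variable {V W E : Type*} (B : Bigraph V W E)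

def NoSelfLoops : Prop := B.G.NoSelfLoops ∧ B.H.NoSelfLoops

/-- The data `V₁, V₂, W₁, W₂, E₁, E₂` untangle `B` via the biedge `e₀`: the graph `G` is the
disjoint union of subgraphs `(V₁, E₁ ∪ {e₀})` and `(V₂, E₂)`, the graph `H` is the disjoint union
of subgraphs `(W₁, E₁)` and `(W₂, E₂ ∪ {e₀})`, where `E` is partitioned into `E₁`, `E₂`, `{e₀}`. -/
structure UntanglesVia (e₀ : E) (V₁ V₂ : Set V) (W₁ W₂ : Set W) (E₁ E₂ : Set E) : Prop where
  isCompl_V : IsCompl V₁ V₂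
  isCompl_W : IsCompl W₁ W₂
  disjoint_E : Disjoint E₁ E₂
  notMem_left : e₀ ∉ E₁
  notMem_right : e₀ ∉ E₂
  cover_E : E₁ ∪ E₂ ∪ {e₀} = Set.univ
  G_left : ∀ e ∈ E₁ ∪ {e₀}, ∀ v ∈ B.G.ends e, v ∈ V₁
  G_right : ∀ e ∈ E₂, ∀ v ∈ B.G.ends e, v ∈ V₂
  H_left : ∀ e ∈ E₁, ∀ w ∈ B.H.ends e, w ∈ W₁
  H_right : ∀ e ∈ E₂ ∪ {e₀}, ∀ w ∈ B.H.ends e, w ∈ W₂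

namespace UntanglesVia

variable {B}
variable {e₀ : E} {V₁ V₂ : Set V} {W₁ W₂ : Set W} {E₁ E₂ : Set E}

/-- The bigraph `B₁ = (G₁' \ {e₀}, H₁')`, with biedges `E₁`. -/
def left (h : B.UntanglesVia e₀ V₁ V₂ W₁ W₂ E₁ E₂) : Bigraph (B.G.endpoints E₁) W₁ E₁ where
  G := B.G.spanned E₁
  H := B.H.subgraph W₁ E₁ h.H_left

/-- The bigraph `B₂ = (G₂', H₂' \ {e₀})`, with biedges `E₂`. -/
def right (h : B.UntanglesVia e₀ V₁ V₂ W₁ W₂ E₁ E₂) : Bigraph V₂ (B.H.endpoints E₂) E₂ where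
  G := B.G.subgraph V₂ E₂ h.G_right
  H := B.H.spanned E₂

end UntanglesVia

section Map

variable [LinearOrder V] [LinearOrder W]

/-- The vector `((x_u - x_v) (y_t - y_w))_e`, where `u ≺ v` are the endpoints of `e` in `G` and
`t ≺ w` those in `H`. -/
noncomputable def edgeVector (x : (V → ℂ) ⧸ B.G.L) (y : (W → ℂ) ⧸ B.H.L) : E → ℂ :=
  fun e => B.G.edgeDiff e x * B.H.edgeDiff e y

/-- The rational map `f_B` from `ℙ(ℂ^V / L_G) × ℙ(ℂ^W / L_H)` to `ℙ(ℂ^E)`, as a partial function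
defined where the edge vector does not vanish. -/
noncomputable def ratMap : B.G.Space × B.H.Space →. ℙ ℂ (E → ℂ) := fun q =>
  ⟨B.edgeVector q.1.rep q.2.rep ≠ 0, fun h => Projectivization.mk ℂ _ h⟩

/-- `f_B` may be computed with any representatives. -/
theorem mem_ratMap_mk (x : (V → ℂ) ⧸ B.G.L) (hx : x ≠ 0) (y : (W → ℂ) ⧸ B.H.L) (hy : y ≠ 0)
    (z : E → ℂ) (hz : z ≠ 0) :
    Projectivization.mk ℂ z hz ∈
        B.ratMap (Projectivization.mk ℂ x hx, Projectivization.mk ℂ y hy) ↔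
      ∃ c : ℂˣ, c • z = B.edgeVector x y := by
  obtain ⟨a, ha⟩ := Projectivization.exists_smul_eq_mk_rep ℂ x hx
  obtain ⟨b, hb⟩ := Projectivization.exists_smul_eq_mk_rep ℂ y hy
  have key : B.edgeVector (Projectivization.mk ℂ x hx).rep (Projectivization.mk ℂ y hy).rep =
      (a * b) • B.edgeVector x y := by
    rw [← ha, ← hb]
    funext e
    simp only [edgeVector, Units.smul_def, map_smul, smul_eq_mul, Pi.smul_apply, Units.val_mul]
    ring
  constructor
  · rintro ⟨h, h'⟩
    obtain ⟨c, hc⟩ := (Projectivization.mk_eq_mk_iff ℂ _ _ _ _).1 h'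
    refine ⟨(a * b)⁻¹ * c, ?_⟩
    rw [mul_smul, hc]
    exact (congrArg _ key).trans (inv_smul_smul _ _)
  · rintro ⟨c, hc⟩
    have key' := key.trans (congrArg _ hc.symm)
    rw [smul_smul] at key'
    have hne : (a * b * c) • z ≠ 0 := (smul_ne_zero_iff_ne _).2 hz
    rw [← key'] at hne
    refine ⟨hne, (Projectivization.mk_eq_mk_iff ℂ _ _ _ _).2 ⟨_, key'.symm⟩⟩

/-- The fibre of `f_B` over `p`. -/
def fiber (p : ℙ ℂ (E → ℂ)) : Set (B.G.Space × B.H.Space) := {q | p ∈ B.ratMap q}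

/-- `f_B` is dominant: its image is Zariski dense. -/
def IsDominant : Prop := IsZariskiDense {p | (B.fiber p).Nonempty}

/-- The degree of `f_B` when it is dominant: the number (possibly `∞`) of points of a general
fibre. Since two nonempty open sets intersect, there is at most one `n` as below, and the
supremum only serves to pick it. -/
noncomputable def degree : ℕ∞ :=
  sSup {n : ℕ∞ | ∃ U : Set (ℙ ℂ (E → ℂ)), IsZariskiOpen U ∧ U.Nonempty ∧
    ∀ p ∈ U, (B.fiber p).encard = n}

open Classical in
/-- The Laman number of a bigraph. -/
noncomputable def lam : ℕ∞ := if B.IsDominant then B.degree else 0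

end Map

end Bigraph

/-! Taking edge differences embeds `ℂ^V / L_G` into `ℂ^E` as the cut space of `G`, and likewise for
`H`. A point of the fibre over `[z]` with `z e ≠ 0` is then a pair `(a, b)` of vectors of the two
cut spaces with coordinatewise product `z`, scaled so that `a e = 1` (`encard_fiber_mk`).

Since `e₀` is not a bridge of `G`, its endpoints are joined by a walk avoiding it, which stays in
the first part; hence `a e₀ = l (a|E₁)` for a linear form `l`, and no other condition links `E₁`,
`E₂` and `e₀` (`exists_cutSpace_form`). In `H`, symmetrically, `b e₀ = m (b|E₂)`. Normalizing by `a
e₀ = 1` forces `b e₀ = z e₀`. The pairs therefore split into independent pairs on `E₁` with `l a =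
1` and, after rescaling, pairs on `E₂` with `m b = 1` (`encard_normalizedPairs_glue`).

These factors count fibres of `B₁` and `B₂` normalized by `l` and `m` instead of by a coordinate.
The two counts could differ only through points where `l` or `m` vanishes. A general fibre of a
polynomial map keeps its cardinality when the zeros of a nonzero polynomial are removed, so
generically they agree (`exists_encard_normalizedPairs`). That fact, infinite and empty fibres
included, is obtained algebraically by adjoining generators one at a time and counting extensions of
homomorphisms (`exists_encard_generic_fiber`). -/

/-! ### Counting extensions of general ring homomorphisms -/

section GenericExtensions

open Polynomial

/-- Pseudo-division: `Q` times a power of the leading coefficient of `P` can be divided by `P`. -/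
theorem Polynomial.exists_pow_leadingCoeff_mul_eq {R : Type*} [CommRing R] [IsDomain R] {P : R[X]}
    (hP : P ≠ 0) (Q : R[X]) :
    ∃ (k : ℕ) (A B : R[X]), C (P.leadingCoeff ^ k) * Q = P * A + B ∧ B.degree < P.degree := by
  induction h : Q.degree using WellFoundedLT.induction generalizing Q with
  | ind n ih =>
    subst h
    by_cases hlt : Q.degree < P.degree
    · exact ⟨0, 0, Q, by simp, hlt⟩
    have hQ : Q ≠ 0 := by
      rintro rfl
      exact hlt (by simpa [bot_lt_iff_ne_bot] using hP)
    have hle : P.natDegree ≤ Q.natDegree := natDegree_le_natDegree (not_lt.1 hlt)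
    have hc : P.leadingCoeff ≠ 0 := leadingCoeff_ne_zero.2 hP
    have hc' : Q.leadingCoeff ≠ 0 := leadingCoeff_ne_zero.2 hQ
    obtain ⟨k, A, B, hAB, hB⟩ := ih
      (C P.leadingCoeff * Q -
        P * (C Q.leadingCoeff * X ^ (Q.natDegree - P.natDegree))).degree
      (by
        have hd : (C P.leadingCoeff * Q).degree = Q.degree := by
          rw [degree_mul, degree_C hc, zero_add]
        refine (degree_sub_lt_left ?_ ?_ ?_).trans_eq hd
        · rw [hd, degree_mul, degree_mul, degree_C hc', degree_X_pow, degree_eq_natDegree hP,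
            degree_eq_natDegree hQ, zero_add]
          exact_mod_cast (Nat.add_sub_cancel' hle).symm
        · exact mul_ne_zero (C_ne_zero.2 hc) hQ
        · rw [leadingCoeff_mul, leadingCoeff_mul, leadingCoeff_mul, leadingCoeff_C, leadingCoeff_C,
            leadingCoeff_X_pow, mul_one]) _ rfl
    refine ⟨k + 1, A + C (P.leadingCoeff ^ k) *
      (C Q.leadingCoeff * X ^ (Q.natDegree - P.natDegree)), B, ?_, hB⟩
    rw [pow_succ, C_mul]
    linear_combination hAB

variable {R S T k : Type*} [CommRing R] [CommRing S] [CommRing T] [Algebra R S] [Field k]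

/-- For a general ring homomorphism `z : R → k`, there are `n` extensions of `z` to `S`, even when
only the extensions are counted that do not vanish at a given nonzero element of `S`. -/
def GenericExtensionCount (R S k : Type*) [CommRing R] [CommRing S] [Algebra R S] [Field k]
    (n : ℕ∞) : Prop :=
  ∀ s : S, s ≠ 0 → ∃ r : R, r ≠ 0 ∧ ∀ z : R →+* k, z r ≠ 0 →
    {w : S →+* k | w.comp (algebraMap R S) = z ∧ w s ≠ 0}.encard = n

theorem RingHom.apply_aeval {θ : S} {z : R →+* k} {w : S →+* k}
    (hw : w.comp (algebraMap R S) = z) (Q : R[X]) : w (aeval θ Q) = eval₂ z (w θ) Q := by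
  rw [aeval_def, hom_eval₂, hw]

/-- Here `S` is `R[X]` modulo the relations of `θ`, so a value `τ` is admissible once it satisfies
all these relations specialized by `z`. -/
theorem RingHom.exists_extension {θ : S} (hθ : Function.Surjective (aeval (R := R) θ))
    (z : R →+* k) (τ : k) (h : ∀ Q : R[X], aeval θ Q = 0 → eval₂ z τ Q = 0) :
    ∃ w : S →+* k, w.comp (algebraMap R S) = z ∧ w θ = τ := by
  have key := RingHom.liftOfSurjective_comp_apply (f := (aeval (R := R) θ).toRingHom) hθ
    ⟨eval₂RingHom z τ, fun Q hQ => h Q hQ⟩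
  refine ⟨RingHom.liftOfSurjective (aeval (R := R) θ).toRingHom hθ
    ⟨eval₂RingHom z τ, fun Q hQ => h Q hQ⟩, RingHom.ext fun r => ?_, ?_⟩
  · simpa using key (C r)
  · simpa using key X

theorem RingHom.injOn_extensions {θ : S} (hθ : Function.Surjective (aeval (R := R) θ))
    (z : R →+* k) :
    Set.InjOn (fun w : S →+* k => w θ) {w | w.comp (algebraMap R S) = z} := by
  intro w hw w' hw' h
  refine RingHom.ext fun s => ?_
  obtain ⟨Q, rfl⟩ := hθ s
  rw [RingHom.apply_aeval hw, RingHom.apply_aeval hw']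
  exact congrArg (fun τ => eval₂ z τ Q) h

/-- Every value of `θ` is admissible, and nonvanishing at `s = Q(θ)` excludes only the finitely many
roots of the specialized `Q`. -/
theorem genericExtensionCount_of_transcendental [Infinite k] {θ : S}
    (hθ : Function.Surjective (aeval (R := R) θ)) (htr : Transcendental R θ) :
    GenericExtensionCount R S k ⊤ := by
  intro s hs
  obtain ⟨Q, rfl⟩ := hθ s
  have hQ : Q ≠ 0 := by
    rintro rfl
    simp at hs
  refine ⟨Q.leadingCoeff, leadingCoeff_ne_zero.2 hQ, fun z hz => ?_⟩
  have hQz : Q.map z ≠ 0 := by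
    intro h
    have := congrArg (fun q => q.coeff Q.natDegree) h
    simp only [coeff_map, coeff_zero, coeff_natDegree] at this
    exact hz this
  rw [Set.encard_eq_top_iff]
  have hinf : {τ : k | (Q.map z).eval τ ≠ 0}.Infinite := by
    classical
    have : {τ : k | (Q.map z).eval τ ≠ 0} = ((Q.map z).roots.toFinset : Set k)ᶜ := by
      ext τ
      simp [hQz]
    rw [this]
    exact (Finset.finite_toSet _).infinite_compl
  refine Set.Infinite.of_image (fun w : S →+* k => w θ) (hinf.mono fun τ hτ => ?_)
  obtain ⟨w, hw, rfl⟩ := RingHom.exists_extension hθ z τ fun Q' hQ' => by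
    rw [transcendental_iff.1 htr Q' hQ', eval₂_zero]
  refine ⟨w, ⟨hw, ?_⟩, rfl⟩
  rw [RingHom.apply_aeval hw, ← eval_map]
  exact hτ

/-- The count is the degree of an annihilating polynomial `P` of `θ` of least degree: extensions
correspond to roots of the specialized `P`, which are generically simple in characteristic zero. -/
theorem genericExtensionCount_of_isAlgebraic [IsDomain R] [CharZero R] [IsDomain S]
    [FaithfulSMul R S] [IsAlgClosed k] {θ : S} (hθ : Function.Surjective (aeval (R := R) θ))
    (halg : IsAlgebraic R θ) : ∃ n : ℕ, n ≠ 0 ∧ GenericExtensionCount R S k n := by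
  classical
  have halg' : ∀ s : S, IsAlgebraic R s := by
    intro s
    obtain ⟨Q, rfl⟩ := hθ s
    exact Algebra.isAlgebraic_adjoin_singleton_iff.2 halg _ (aeval_mem_adjoin_singleton R θ)
  obtain ⟨P, ⟨hP0, hP⟩, hmin⟩ := exists_minimalFor_of_wellFoundedLT
    (fun P : R[X] => P ≠ 0 ∧ aeval θ P = 0) natDegree halg
  have hmin' : ∀ Q : R[X], Q.degree < P.degree → aeval θ Q = 0 → Q = 0 := by
    intro Q hQ hQ'
    by_contra h
    exact (natDegree_lt_natDegree h hQ).not_ge (hmin ⟨h, hQ'⟩ (natDegree_lt_natDegree h hQ).le)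
  have hdeg : P.natDegree ≠ 0 := by
    intro h
    rw [eq_C_of_natDegree_eq_zero h, aeval_C, FaithfulSMul.algebraMap_eq_zero_iff R S] at hP
    exact hP0 (by rw [eq_C_of_natDegree_eq_zero h, hP, C_0])
  have hδ : aeval θ (derivative P) ≠ 0 := by
    intro h
    exact hdeg (derivative_eq_zero.1
      (hmin' _ (degree_derivative_lt hP0) h))
  refine ⟨P.natDegree, hdeg, fun s hs => ?_⟩
  obtain ⟨r₀, hr₀, δ', hδ'⟩ := (halg' _).exists_nonzero_dvd (mem_nonZeroDivisors_of_ne_zero hδ)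
  obtain ⟨r₁, hr₁, s', hs'⟩ := (halg' _).exists_nonzero_dvd (mem_nonZeroDivisors_of_ne_zero hs)
  -- The leading coefficient preserves the degree of `P`; `r₀`, a multiple of `P'(θ)`, keeps the
  -- roots simple; `r₁`, a multiple of `s`, prevents any extension from vanishing at `s`.
  refine ⟨P.leadingCoeff * r₀ * r₁,
    mul_ne_zero (mul_ne_zero (leadingCoeff_ne_zero.2 hP0) hr₀) hr₁, fun z hz => ?_⟩
  simp only [map_mul, mul_ne_zero_iff] at hz
  obtain ⟨⟨hzc, hz₀⟩, hz₁⟩ := hz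
  have hdz : (P.map z).natDegree = P.natDegree := natDegree_map_of_leadingCoeff_ne_zero z hzc
  have hPz : P.map z ≠ 0 := fun h => hdeg (by rw [← hdz, h, natDegree_zero])
  have hext : ∀ τ : k, (P.map z).IsRoot τ →
      ∃ w : S →+* k, w.comp (algebraMap R S) = z ∧ w θ = τ := by
    refine fun τ hτ => RingHom.exists_extension hθ z τ fun Q hQ => ?_
    -- The pseudo-remainder of a relation of `θ` is a relation of smaller degree than `P`, hence
    -- zero; so roots of the specialized `P` satisfy all relations.
    obtain ⟨m, A, B, hAB, hB⟩ := exists_pow_leadingCoeff_mul_eq hP0 Q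
    have hB0 : B = 0 := by
      refine hmin' B hB ?_
      have := congrArg (aeval θ) hAB
      simpa [hQ, hP, eq_comm] using this
    rw [IsRoot, eval_map] at hτ
    have := congrArg (eval₂ z τ) hAB
    rw [hB0, add_zero, eval₂_mul, eval₂_mul, hτ, zero_mul, eval₂_C, map_pow] at this
    exact (mul_eq_zero.1 this).resolve_left (pow_ne_zero _ hzc)
  have hne : ∀ {a b : S} {r : R}, algebraMap R S r = a * b → z r ≠ 0 →
      ∀ w : S →+* k, w.comp (algebraMap R S) = z → w a ≠ 0 := by
    intro a b r hab hr w hw h0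
    have := congrArg w hab
    rw [map_mul, h0, zero_mul, ← RingHom.comp_apply, hw] at this
    exact hr this
  have hnodup : (P.map z).roots.Nodup := by
    rw [Multiset.nodup_iff_count_le_one]
    intro τ
    rw [count_roots]
    by_contra! h
    obtain ⟨h1, h2⟩ := (one_lt_rootMultiplicity_iff_isRoot hPz).1 h
    obtain ⟨w, hw, rfl⟩ := hext τ h1
    refine hne hδ' hz₀ w hw ?_
    rw [RingHom.apply_aeval hw, ← eval_map, ← derivative_map]
    exact h2
  have himage : (fun w : S →+* k => w θ) '' {w | w.comp (algebraMap R S) = z ∧ w s ≠ 0} =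
      ((P.map z).roots.toFinset : Set k) := by
    ext τ
    simp only [Set.mem_image, Set.mem_ofPred_eq, Finset.mem_coe, Multiset.mem_toFinset,
      mem_roots hPz]
    constructor
    · rintro ⟨w, ⟨hw, -⟩, rfl⟩
      rw [IsRoot, eval_map, ← RingHom.apply_aeval hw, hP, map_zero]
    · intro hτ
      obtain ⟨w, hw, rfl⟩ := hext τ hτ
      exact ⟨w, ⟨hw, hne hs' hz₁ w hw⟩, rfl⟩
  rw [← ((RingHom.injOn_extensions hθ z).mono fun w hw => hw.1).encard_image, himage,
    Set.encard_coe_eq_coe_finsetCard, Multiset.toFinset_card_of_nodup hnodup,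
    IsAlgClosed.card_roots_eq_natDegree, hdz]

/-- Extensions to `T` are grouped by their restriction `v` to `S`; those with `v s ≠ 0` have `n`
continuations each. For `m = ⊤`, `n ≠ 0` already gives infinitely many extensions. For finite `m`,
no `v` with `v s = 0` may be overlooked. -/
theorem GenericExtensionCount.trans [Algebra S T] [Algebra R T] [IsScalarTower R S T] [IsDomain R]
    [Nontrivial S] {m n : ℕ∞} (hn : n ≠ 0) (h₁ : GenericExtensionCount R S k m)
    (h₂ : GenericExtensionCount S T k n) : GenericExtensionCount R T k (m * n) := by
  intro t ht
  obtain ⟨s, hs, h₂⟩ := h₂ t ht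
  obtain ⟨r, hr, hrs⟩ := h₁ s hs
  -- Taking `1` counts all extensions to `S`. When this number is finite, its equality with the
  -- count for `s` shows that no extension vanishes at `s`.
  obtain ⟨r', hr', hrs'⟩ := h₁ 1 one_ne_zero
  refine ⟨r * r', mul_ne_zero hr hr', fun z hz => ?_⟩
  rw [map_mul, mul_ne_zero_iff] at hz
  have hrs := hrs z hz.1
  have hrs' := hrs' z hz.2
  simp only [map_one, ne_eq, one_ne_zero, not_false_eq_true, and_true] at hrs'
  set X := {v : S →+* k | v.comp (algebraMap R S) = z ∧ v s ≠ 0} with hX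
  set Y : (S →+* k) → Set (T →+* k) := fun v => {w | w.comp (algebraMap S T) = v ∧ w t ≠ 0}
    with hY
  have hcomp : ∀ w : T →+* k, w.comp (algebraMap R T) =
      (w.comp (algebraMap S T)).comp (algebraMap R S) := by
    intro w
    rw [RingHom.comp_assoc, ← IsScalarTower.algebraMap_eq]
  by_cases hm : m = ⊤
  · have hsub : X ⊆ (fun w : T →+* k => w.comp (algebraMap S T)) ''
        {w | w.comp (algebraMap R T) = z ∧ w t ≠ 0} := by
      intro v hv
      have hYv : (Y v).encard ≠ 0 := by
        rw [h₂ v hv.2]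
        exact hn
      obtain ⟨w, hw, hwt⟩ := Set.encard_ne_zero.1 hYv
      refine ⟨w, ⟨?_, hwt⟩, hw⟩
      rw [hcomp, hw, hv.1]
    have := (Set.encard_le_encard hsub).trans (Set.encard_image_le _ _)
    rw [hrs, hm, top_le_iff] at this
    rw [this, hm, ENat.top_mul hn]
  · have hfin : {v : S →+* k | v.comp (algebraMap R S) = z}.Finite := by
      rw [← Set.encard_ne_top_iff, hrs']
      exact hm
    have hXeq : X = {v : S →+* k | v.comp (algebraMap R S) = z} :=
      hfin.eq_of_subset_of_encard_le' (fun v hv => hv.1) (hrs'.trans hrs.symm).le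
    have hXfin : X.Finite := hXeq ▸ hfin
    have hunion : {w : T →+* k | w.comp (algebraMap R T) = z ∧ w t ≠ 0} = ⋃ v ∈ X, Y v := by
      ext w
      simp only [Set.mem_ofPred_eq, Set.mem_iUnion, hXeq, hY, exists_prop]
      constructor
      · rintro ⟨hw, hwt⟩
        exact ⟨_, (hcomp w).symm.trans hw, rfl, hwt⟩
      · rintro ⟨v, hv, rfl, hwt⟩
        exact ⟨(hcomp w).trans hv, hwt⟩
    rw [hunion, hXfin.encard_biUnion, finsum_mem_congr rfl fun v hv => h₂ v (hX.subset hv).2, ← hrs]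
    · rw [finsum_mem_eq_finite_toFinset_sum _ hXfin, Finset.sum_const,
        hXfin.encard_eq_coe_toFinset_card, nsmul_eq_mul]
    · intro v _ v' _ hvv'
      refine Set.disjoint_left.2 fun w hw hw' => hvv' (hw.1.symm.trans hw'.1)

theorem GenericExtensionCount.congr [Algebra R T] {n : ℕ∞} (e : S ≃ₐ[R] T)
    (h : GenericExtensionCount R S k n) : GenericExtensionCount R T k n := by
  intro t ht
  obtain ⟨r, hr, h⟩ := h (e.symm t) (by simpa using ht)
  refine ⟨r, hr, fun z hz => ?_⟩
  rw [← h z hz]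
  refine Set.encard_congr (Equiv.subtypeEquiv
    ⟨fun w => w.comp (e : S →+* T), fun w => w.comp (e.symm : T →+* S),
      fun w => by ext; simp, fun w => by ext; simp⟩ fun w => ?_)
  simp only [Set.mem_ofPred_eq, Equiv.coe_fn_mk, RingHom.comp_apply, RingHom.coe_coe,
    AlgEquiv.apply_symm_apply, RingHom.comp_assoc]
  rw [← AlgEquiv.toAlgHom_toRingHom, AlgHom.comp_algebraMap]

/-- Each adjoined generator is algebraic or transcendental over the previous ring, and the counts
multiply along the tower. -/
theorem exists_genericExtensionCount_adjoin [IsDomain T] [CharZero T] [Algebra R T]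
    [FaithfulSMul R T] [IsAlgClosed k] (s : Finset T) :
    ∃ n : ℕ∞, n ≠ 0 ∧ GenericExtensionCount R (Algebra.adjoin R (s : Set T)) k n := by
  classical
  have hinj : Function.Injective (algebraMap R T) := FaithfulSMul.algebraMap_injective R T
  have : IsDomain R := hinj.isDomain
  induction s using Finset.induction_on with
  | empty =>
    rw [Finset.coe_empty, Algebra.adjoin_empty]
    refine ⟨1, one_ne_zero, GenericExtensionCount.congr
      (Algebra.botEquivOfInjective hinj).symm fun s hs => ⟨s, hs, fun z hz => ?_⟩⟩
    rw [Set.encard_eq_one]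
    refine ⟨z, Set.ext fun w => ⟨fun hw => ?_, ?_⟩⟩
    · exact RingHom.ext fun r => RingHom.congr_fun hw.1 r
    · rintro rfl
      exact ⟨RingHom.ext fun _ => rfl, hz⟩
  | insert θ s _ ih =>
    obtain ⟨m, hm, hs⟩ := ih
    set S := Algebra.adjoin R (s : Set T)
    have hstep : ∃ n : ℕ∞, n ≠ 0 ∧
        GenericExtensionCount S (Algebra.adjoin S ({θ} : Set T)) k n := by
      have hθ : Function.Surjective (aeval (R := S)
          (⟨θ, Algebra.self_mem_adjoin_singleton S θ⟩ : Algebra.adjoin S ({θ} : Set T))) := by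
        rintro ⟨x, hx⟩
        obtain ⟨Q, rfl⟩ := (Algebra.adjoin_singleton_eq_range_aeval S θ).le hx
        exact ⟨Q, Subtype.ext (by simp)⟩
      have : FaithfulSMul S (Algebra.adjoin S ({θ} : Set T)) :=
        (faithfulSMul_iff_algebraMap_injective _ _).2 fun a b hab =>
          Subtype.ext (congrArg (fun x : Algebra.adjoin S ({θ} : Set T) => (x : T)) hab)
      by_cases halg : IsAlgebraic S
          (⟨θ, Algebra.self_mem_adjoin_singleton S θ⟩ : Algebra.adjoin S ({θ} : Set T))
      · obtain ⟨n, hn, h⟩ := genericExtensionCount_of_isAlgebraic (k := k) hθ halg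
        exact ⟨n, by exact_mod_cast hn, h⟩
      · exact ⟨⊤, ENat.top_ne_zero, genericExtensionCount_of_transcendental hθ halg⟩
    obtain ⟨n, hn, h⟩ := hstep
    refine ⟨m * n, mul_ne_zero hm hn, (hs.trans hn h).congr
      (T := Algebra.adjoin R ((insert θ s : Finset T) : Set T)) ?_⟩
    refine Subalgebra.equivOfEq ((Algebra.adjoin S ({θ} : Set T)).restrictScalars R) _ ?_
    rw [Finset.coe_insert, Set.insert_eq, Set.union_comm, Algebra.adjoin_union_eq_adjoin_adjoin]

theorem exists_genericExtensionCount [IsDomain T] [CharZero T] [Algebra R T]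
    [FaithfulSMul R T] [IsAlgClosed k] [Algebra.FiniteType R T] :
    ∃ n : ℕ∞, n ≠ 0 ∧ GenericExtensionCount R T k n := by
  obtain ⟨s, hs⟩ := Algebra.FiniteType.out (R := R) (A := T)
  obtain ⟨n, hn, h⟩ := exists_genericExtensionCount_adjoin (R := R) (k := k) s
  rw [hs] at h
  exact ⟨n, hn, h.congr Subalgebra.topEquiv⟩

end GenericExtensions

/-! ### General fibres of polynomial maps -/

section GenericFibers

open MvPolynomial

/-- The fibre of a polynomial map over `z` is the set of ring homomorphisms extending the evaluation
at `z`. -/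
theorem encard_extensions_eval {ι σ k : Type*} [Field k]
    [Algebra (MvPolynomial ι k) (MvPolynomial σ k)] {φ : ι → MvPolynomial σ k}
    (hφ : algebraMap (MvPolynomial ι k) (MvPolynomial σ k) = (aeval (R := k) φ).toRingHom)
    (z : ι → k) (s : MvPolynomial σ k) :
    {w : MvPolynomial σ k →+* k | w.comp (algebraMap (MvPolynomial ι k) (MvPolynomial σ k)) =
      eval z ∧ w s ≠ 0}.encard =
    {x : σ → k | (∀ i, eval x (φ i) = z i) ∧ eval x s ≠ 0}.encard := by
  have heval : ∀ w : MvPolynomial σ k →+* k,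
      w.comp (algebraMap (MvPolynomial ι k) (MvPolynomial σ k)) = eval z →
      w = eval fun j => w (X j) := by
    intro w hw
    refine MvPolynomial.ringHom_ext (fun c => ?_) fun j => by simp
    have := RingHom.congr_fun hw (C c)
    rw [hφ] at this
    simpa using this
  refine Set.encard_congr (Set.BijOn.equiv (fun w j => w (X j)) ⟨?_, ?_, ?_⟩)
  · rintro w ⟨hw, hs⟩
    rw [heval w hw] at hs
    refine ⟨fun i => ?_, hs⟩
    rw [← heval w hw]
    simpa [hφ] using RingHom.congr_fun hw (X i)
  · rintro w ⟨hw, -⟩ w' ⟨hw', -⟩ h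
    rw [heval w hw, heval w' hw']
    exact congrArg _ h
  · rintro x ⟨hx, hs⟩
    refine ⟨eval x, ⟨?_, hs⟩, by simp⟩
    rw [hφ]
    refine MvPolynomial.ringHom_ext (fun c => by simp) fun i => by simpa using hx i

/-- All general fibres of a polynomial map have the same cardinality (zero if the map is not
dominant), also after removing the zeros of a nonzero polynomial `s`. -/
theorem exists_encard_generic_fiber {ι σ k : Type*} [Finite σ] [Field k] [IsAlgClosed k]
    [CharZero k] (φ : ι → MvPolynomial σ k) {s : MvPolynomial σ k} (hs : s ≠ 0) :
    ∃ (n : ℕ∞) (g : MvPolynomial ι k), g ≠ 0 ∧ ∀ z : ι → k, eval z g ≠ 0 →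
      {x : σ → k | ∀ i, eval x (φ i) = z i}.encard = n ∧
      {x : σ → k | (∀ i, eval x (φ i) = z i) ∧ eval x s ≠ 0}.encard = n := by
  by_cases hφ : AlgebraicIndependent k φ
  · let : Algebra (MvPolynomial ι k) (MvPolynomial σ k) := (aeval φ).toRingHom.toAlgebra
    have hmap : algebraMap (MvPolynomial ι k) (MvPolynomial σ k) =
        (aeval (R := k) φ).toRingHom := rfl
    have : FaithfulSMul (MvPolynomial ι k) (MvPolynomial σ k) :=
      (faithfulSMul_iff_algebraMap_injective _ _).2 hφ
    have : IsScalarTower k (MvPolynomial ι k) (MvPolynomial σ k) :=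
      IsScalarTower.of_algebraMap_eq fun c => ((aeval φ).commutes c).symm
    have : Algebra.FiniteType (MvPolynomial ι k) (MvPolynomial σ k) :=
      Algebra.FiniteType.of_restrictScalars_finiteType k _ _
    obtain ⟨n, -, h⟩ := exists_genericExtensionCount (R := MvPolynomial ι k)
      (T := MvPolynomial σ k) (k := k)
    obtain ⟨g, hg, h₁⟩ := h 1 one_ne_zero
    obtain ⟨g', hg', h₂⟩ := h s hs
    refine ⟨n, g * g', mul_ne_zero hg hg', fun z hz => ?_⟩
    rw [map_mul, mul_ne_zero_iff] at hz
    have h₁ := h₁ (eval z) hz.1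
    have h₂ := h₂ (eval z) hz.2
    rw [encard_extensions_eval hmap] at h₁ h₂
    refine ⟨?_, h₂⟩
    simpa using h₁
  -- A nonzero relation among the `φ i` vanishes on the image, so fibres off its zero set are empty.
  · rw [AlgebraicIndependent, injective_iff_map_eq_zero] at hφ
    push Not at hφ
    obtain ⟨g, hg, hg0⟩ := hφ
    refine ⟨0, g, hg0, fun z hz => ?_⟩
    have : ∀ x : σ → k, ¬ ∀ i, eval x (φ i) = z i := by
      intro x hx
      refine hz ?_
      have key : (eval x).comp (aeval (R := k) φ).toRingHom = eval z :=
        MvPolynomial.ringHom_ext (fun c => by simp) fun i => by simpa using hx i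
      rw [← key, RingHom.comp_apply]
      exact (congrArg (eval x) hg).trans (map_zero _)
    simp [this]

end GenericFibers

/-! ### Factorizations of a vector over two subspaces -/

section ProductFibers

variable {k E : Type*} [Field k]

/-- The pairs `(a, b) ∈ A × B`, normalized by `l a = 1`, whose coordinatewise product is `z`. -/
def normalizedPairs (A B : Submodule k (E → k)) (l : (E → k) →ₗ[k] k) (z : E → k) :
    Set ((E → k) × (E → k)) :=
  {p | p.1 ∈ A ∧ p.2 ∈ B ∧ l p.1 = 1 ∧ p.1 * p.2 = z}

/-- Rescaling to `(a / m a, m a • b)` preserves the product. It is possible only where `m a ≠ 0`,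
whence the side conditions. -/
theorem encard_normalizedPairs_change_form (A B : Submodule k (E → k)) (l m : (E → k) →ₗ[k] k)
    (z : E → k) :
    {p ∈ normalizedPairs A B l z | m p.1 ≠ 0}.encard =
      {p ∈ normalizedPairs A B m z | l p.1 ≠ 0}.encard := by
  refine Set.encard_congr (Set.BijOn.equiv
    (fun p => ((m p.1)⁻¹ • p.1, m p.1 • p.2)) ⟨?_, ?_, ?_⟩)
  · rintro ⟨a, b⟩ ⟨⟨ha, hb, hl, hz⟩, hm⟩
    simp only at hl hz hm
    refine ⟨⟨A.smul_mem _ ha, B.smul_mem _ hb, by simp [hm], ?_⟩, by simp [hl, hm]⟩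
    simp [hz, smul_smul, hm]
  · rintro ⟨a, b⟩ ⟨⟨ha, hb, hl, hz⟩, hm⟩ ⟨a', b'⟩ ⟨⟨ha', hb', hl', hz'⟩, hm'⟩ h
    simp only [Prod.mk.injEq] at hl hl' hm hm' h ⊢
    have h1 := congrArg l h.1
    simp only [map_smul, hl, hl', smul_eq_mul, mul_one] at h1
    rw [h1] at h
    rw [inv_inj] at h1
    rw [h1] at h
    exact ⟨smul_right_injective _ (inv_ne_zero hm') h.1, smul_right_injective _ hm' h.2⟩
  · rintro ⟨a, b⟩ ⟨⟨ha, hb, hm, hz⟩, hl⟩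
    simp only at hm hz hl
    refine ⟨((l a)⁻¹ • a, l a • b),
      ⟨⟨A.smul_mem _ ha, B.smul_mem _ hb, by simp [hl], by simp [smul_smul, hl, hz]⟩, ?_⟩, ?_⟩
    · simp [hm, hl]
    · simp [hm, hl, smul_smul]

/-- If `a e = 1` then `b e = z e ≠ 0`, so the normalization can be moved to the other factor by
scaling. -/
theorem encard_normalizedPairs_swap (A B : Submodule k (E → k)) (e : E) {z : E → k}
    (hz : z e ≠ 0) :
    (normalizedPairs A B (LinearMap.proj e) z).encard =
      (normalizedPairs B A (LinearMap.proj e) z).encard := by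
  have key : ∀ a b : E → k, a * b = z → a e * b e = z e := fun a b h => congrFun h e
  refine Set.encard_congr (Set.BijOn.equiv
    (fun p => ((p.2 e)⁻¹ • p.2, p.2 e • p.1)) ⟨?_, ?_, ?_⟩)
  · rintro ⟨a, b⟩ ⟨ha, hb, hl, hp⟩
    simp only [LinearMap.proj_apply] at hl hp
    have := key a b hp
    rw [hl, one_mul] at this
    have hbe : b e ≠ 0 := this ▸ hz
    exact ⟨B.smul_mem _ hb, A.smul_mem _ ha, by simp [hbe], by simp [smul_smul, hbe, ← hp, mul_comm]⟩
  · rintro ⟨a, b⟩ ⟨ha, hb, hl, hp⟩ ⟨a', b'⟩ ⟨ha', hb', hl', hp'⟩ h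
    simp only [LinearMap.proj_apply, Prod.mk.injEq] at hl hp hl' hp' h ⊢
    have h1 := key a b hp
    have h2 := key a' b' hp'
    rw [hl, one_mul] at h1
    rw [hl', one_mul] at h2
    rw [h1, h2] at h
    exact ⟨smul_right_injective _ hz h.2, smul_right_injective _ (inv_ne_zero hz) h.1⟩
  · rintro ⟨b, a⟩ ⟨hb, ha, hl, hp⟩
    simp only [LinearMap.proj_apply] at hl hp
    have h1 := key b a hp
    rw [hl, one_mul] at h1
    have hae : a e ≠ 0 := h1 ▸ hz
    refine ⟨((a e)⁻¹ • a, a e • b), ⟨A.smul_mem _ ha, B.smul_mem _ hb, by simp [hae],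
      by simp [smul_smul, hae, ← hp, mul_comm]⟩, ?_⟩
    simp [hl, hae, smul_smul]

theorem normalizedPairs_eq_sep (A B : Submodule k (E → k)) (l : (E → k) →ₗ[k] k) {e : E}
    {z : E → k} (hz : z e ≠ 0) :
    {p ∈ normalizedPairs A B l z | (LinearMap.proj e : (E → k) →ₗ[k] k) p.1 ≠ 0} =
      normalizedPairs A B l z := by
  refine Set.sep_eq_self_iff_mem_true.2 ?_
  rintro ⟨a, b⟩ ⟨-, -, -, hp⟩ h0
  refine hz ?_
  rw [← hp]
  exact mul_eq_zero_of_left h0 _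

/-- A general product fibre has the same cardinality for all normalizations. -/
theorem exists_encard_normalizedPairs [Finite E] [IsAlgClosed k] [CharZero k]
    (A B : Submodule k (E → k)) (l : (E → k) →ₗ[k] k) (hl : ∃ a ∈ A, l a ≠ 0) (e : E) :
    ∃ (n : ℕ∞) (g : MvPolynomial E k), g ≠ 0 ∧ ∀ z : E → k, MvPolynomial.eval z g ≠ 0 →
      (normalizedPairs A B (LinearMap.proj e) z).encard = n ∧
      (normalizedPairs A B l z).encard = n := by
  suffices h : ∃ (n : ℕ∞) (g : MvPolynomial E k), g ≠ 0 ∧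
      ∀ z : E → k, MvPolynomial.eval z g ≠ 0 →
        (normalizedPairs A B (LinearMap.proj e) z).encard = n ∧
        {p ∈ normalizedPairs A B (LinearMap.proj e) z | l p.1 ≠ 0}.encard = n by
    obtain ⟨n, g, hg, h⟩ := h
    refine ⟨n, g * MvPolynomial.X e, mul_ne_zero hg (MvPolynomial.X_ne_zero e), fun z hz => ?_⟩
    rw [map_mul, MvPolynomial.eval_X, mul_ne_zero_iff] at hz
    obtain ⟨h1, h2⟩ := h z hz.1
    rw [encard_normalizedPairs_change_form, normalizedPairs_eq_sep A B l hz.2] at h2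
    exact ⟨h1, h2⟩
  by_cases hA : ∃ a ∈ A, a e = 1
  · obtain ⟨a₀, ha₀, ha₀e⟩ := hA
    -- The slice `a e = 1` of `A` is `a₀ + K`, so coordinates on `K` and `B` turn the normalized
    -- pairs into fibres of a polynomial map `φ`, and `l a` into a polynomial `s`.
    let K : Submodule k (E → k) := A ⊓ LinearMap.ker (LinearMap.proj e : (E → k) →ₗ[k] k)
    have hK : ∀ a ∈ A, a - a e • a₀ ∈ K := fun a ha =>
      ⟨A.sub_mem ha (A.smul_mem _ ha₀), by simp [ha₀e]⟩
    let bK := Module.finBasis k K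
    let bB := Module.finBasis k B
    let param : (Fin (Module.finrank k K) ⊕ Fin (Module.finrank k B) → k) →
        (E → k) × (E → k) := fun x =>
      (a₀ + bK.equivFun.symm (fun j => x (Sum.inl j)), bB.equivFun.symm fun j => x (Sum.inr j))
    let φ : E → MvPolynomial (Fin (Module.finrank k K) ⊕ Fin (Module.finrank k B)) k := fun i =>
      (MvPolynomial.C (a₀ i) +
          ∑ j, MvPolynomial.X (Sum.inl j) * MvPolynomial.C ((bK j : E → k) i)) *
        ∑ j, MvPolynomial.X (Sum.inr j) * MvPolynomial.C ((bB j : E → k) i)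
    let s : MvPolynomial (Fin (Module.finrank k K) ⊕ Fin (Module.finrank k B)) k :=
      MvPolynomial.C (l a₀) + ∑ j, MvPolynomial.X (Sum.inl j) * MvPolynomial.C (l (bK j))
    have hφ : ∀ x i, MvPolynomial.eval x (φ i) = ((param x).1 * (param x).2) i := by
      intro x i
      simp [φ, param, Module.Basis.equivFun_symm_apply]
    have hs : ∀ x, MvPolynomial.eval x s = l (param x).1 := by
      intro x
      simp [s, param, Module.Basis.equivFun_symm_apply]
    -- As `A` is spanned by `a₀` and `K`, a form vanishing on `a₀ + K` would vanish on `A`.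
    have hs0 : s ≠ 0 := by
      intro h0
      have hzero : ∀ c : K, l (a₀ + c) = 0 := by
        intro c
        have := hs (Sum.elim (bK.equivFun c) 0)
        rw [h0, map_zero] at this
        simpa only [param, Sum.elim_inl, LinearEquiv.symm_apply_apply] using this.symm
      obtain ⟨a, ha, hla⟩ := hl
      have h1 := hzero 0
      have h2 := hzero ⟨_, hK a ha⟩
      simp only [ZeroMemClass.coe_zero, add_zero] at h1
      simp only [map_add, map_sub, map_smul, h1, smul_zero, sub_zero, zero_add] at h2
      exact hla h2
    have hbij : ∀ z, Set.BijOn param {x | ∀ i, MvPolynomial.eval x (φ i) = z i}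
        (normalizedPairs A B (LinearMap.proj e) z) := by
      refine fun z => ⟨?_, ?_, ?_⟩
      · intro x hx
        obtain ⟨hcA, hce⟩ := (bK.equivFun.symm fun j => x (Sum.inl j)).2
        refine ⟨A.add_mem ha₀ hcA, (bB.equivFun.symm fun j => x (Sum.inr j)).2, ?_, ?_⟩
        · exact (map_add _ _ _).trans (congrArg₂ (· + ·) ha₀e hce) |>.trans (add_zero 1)
        · funext i
          rw [← hφ]
          exact hx i
      · intro x _ y _ hxy
        simp only [param, Prod.mk.injEq, add_right_inj, SetLike.coe_eq_coe,
          EmbeddingLike.apply_eq_iff_eq] at hxy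
        funext j
        rcases j with j | j
        · exact congrFun hxy.1 j
        · exact congrFun hxy.2 j
      · rintro ⟨a, b⟩ ⟨ha, hb, hae, hz⟩
        simp only [LinearMap.proj_apply] at hae
        have hp : param (Sum.elim (bK.equivFun ⟨_, hK a ha⟩) (bB.equivFun ⟨b, hb⟩)) = (a, b) := by
          simp only [param, Sum.elim_inl, Sum.elim_inr, LinearEquiv.symm_apply_apply]
          simp [hae]
        refine ⟨_, fun i => ?_, hp⟩
        rw [hφ, hp]
        exact congrFun hz i
    obtain ⟨n, g, hg, h⟩ := exists_encard_generic_fiber φ hs0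
    refine ⟨n, g, hg, fun z hz => ?_⟩
    obtain ⟨h1, h2⟩ := h z hz
    rw [← h1]
    refine ⟨(Set.encard_congr (hbij z).equiv).symm, ?_⟩
    rw [h1, ← h2]
    refine (Set.encard_congr (Set.BijOn.equiv param ⟨?_, ?_, ?_⟩)).symm
    · rintro x ⟨hx, hxs⟩
      exact ⟨(hbij z).mapsTo hx, by rwa [← hs]⟩
    · exact (hbij z).injOn.mono fun x hx => hx.1
    · rintro p ⟨hp, hlp⟩
      obtain ⟨x, hx, rfl⟩ := (hbij z).surjOn hp
      exact ⟨x, ⟨hx, by rwa [hs]⟩, rfl⟩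
  · refine ⟨0, 1, one_ne_zero, fun z _ => ?_⟩
    have : normalizedPairs A B (LinearMap.proj e) z = ∅ := by
      refine Set.eq_empty_of_forall_notMem fun p hp => hA ⟨p.1, hp.1, hp.2.2.1⟩
    simp [this]

end ProductFibers

/-! ### Cut spaces of graphs -/

theorem Sym2.attachWith_inf_coe {α : Type*} [LinearOrder α] {P : α → Prop} (s : Sym2 α)
    (h : ∀ a ∈ s, P a) : ((s.attachWith h).inf : α) = s.inf := by
  conv_rhs => rw [← Sym2.attachWith_map_subtypeVal h]
  induction s.attachWith h with
  | h u v => exact (Subtype.mono_coe P).map_inf u v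

theorem Sym2.attachWith_sup_coe {α : Type*} [LinearOrder α] {P : α → Prop} (s : Sym2 α)
    (h : ∀ a ∈ s, P a) : ((s.attachWith h).sup : α) = s.sup := by
  conv_rhs => rw [← Sym2.attachWith_map_subtypeVal h]
  induction s.attachWith h with
  | h u v => exact (Subtype.mono_coe P).map_sup u v

theorem Sym2.mk_inf_sup {α : Type*} [LinearOrder α] (s : Sym2 α) : s(s.inf, s.sup) = s := by
  induction s with
  | h u v => rcases le_total u v with h | h <;> simp [h, Sym2.eq_swap]

theorem Sym2.inf_ne_sup {α : Type*} [LinearOrder α] {s : Sym2 α} (h : ¬ s.IsDiag) :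
    s.inf ≠ s.sup := by
  rw [← Sym2.mk_inf_sup s, Sym2.mk_isDiag_iff] at h
  exact h

namespace Multigraph

variable {V E : Type*} (G : Multigraph V E)

theorem inf_mem_ends [LinearOrder V] (e : E) : (G.ends e).inf ∈ G.ends e :=
  ⟨_, (Sym2.mk_inf_sup _).symm⟩

theorem sup_mem_ends [LinearOrder V] (e : E) : (G.ends e).sup ∈ G.ends e :=
  ⟨_, (Sym2.mk_inf_sup _).symm.trans Sym2.eq_swap⟩

/-- Functions that are constant on the connected components lie in `L_G`. -/
theorem mem_L_of_sameComponent [Finite V] {x : V → ℂ}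
    (hx : ∀ u v, G.SameComponent u v → x u = x v) : x ∈ G.L := by
  obtain ⟨j, hj⟩ : ∃ j : (G.skeleton Set.univ).ConnectedComponent → ℂ, Function.Injective j := by
    obtain ⟨n, ⟨f⟩⟩ := Finite.exists_equiv_fin (G.skeleton Set.univ).ConnectedComponent
    exact ⟨fun c => ((f c : ℕ) : ℂ), fun a b h => f.injective (Fin.ext (Nat.cast_injective h))⟩
  let y : V → ℂ := fun v => j ((G.skeleton Set.univ).connectedComponentMk v)
  have hy : ∀ u v, y u = y v ↔ G.SameComponent u v := fun u v =>
    hj.eq_iff.trans SimpleGraph.ConnectedComponent.eq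
  -- Since `y` separates components, each pair of vertices in different components excludes one `t`;
  -- for any other `t`, both `x + t • y` and `y` are generators of `L_G`.
  obtain ⟨t, ht⟩ := (Set.finite_range fun p : V × V =>
    -(x p.1 - x p.2) / (y p.1 - y p.2)).exists_notMem
  have h1 : x + t • y ∈ G.L := by
    refine Submodule.subset_span fun u v => ⟨fun h => ?_, fun h => ?_⟩
    · by_contra huv
      rw [← hy, ← sub_eq_zero] at huv
      refine ht ⟨(u, v), ?_⟩
      simp only [Pi.add_apply, Pi.smul_apply, smul_eq_mul] at h
      rw [div_eq_iff huv]
      linear_combination -h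
    · simp [hx u v h, (hy u v).2 h]
  have h2 : y ∈ G.L := Submodule.subset_span hy
  simpa using G.L.sub_mem h1 (G.L.smul_mem t h2)

/-- Removing `e` gives a surjection between finite sets of components; if their number does not
grow, it is injective. -/
theorem reachable_of_not_isBridge [Finite V] {e : E} (h : ¬ G.IsBridge e) {u v : V}
    (huv : G.SameComponent u v) : (G.skeleton {e}ᶜ).Reachable u v := by
  by_contra hne
  refine h ?_
  have hle : G.skeleton {e}ᶜ ≤ G.skeleton Set.univ :=
    SimpleGraph.fromEdgeSet_mono (Set.image_mono (Set.subset_univ _))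
  let f : (G.skeleton {e}ᶜ).ConnectedComponent → (G.skeleton Set.univ).ConnectedComponent :=
    SimpleGraph.ConnectedComponent.map (SimpleGraph.Hom.ofLE hle)
  have hf : Function.Surjective f := by
    intro c
    induction c using SimpleGraph.ConnectedComponent.ind with
    | h v => exact ⟨(G.skeleton {e}ᶜ).connectedComponentMk v, rfl⟩
  refine lt_of_le_of_ne (Nat.card_le_card_of_surjective f hf) fun heq => hne ?_
  have hinj := ((Nat.bijective_iff_surjective_and_card f).2 ⟨hf, heq.symm⟩).1
  refine SimpleGraph.ConnectedComponent.eq.1 (hinj ?_)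
  exact SimpleGraph.ConnectedComponent.eq.2 huv

variable [LinearOrder V]

/-- All the edge differences of a vector of `ℂ^V / L_G`. -/
noncomputable def coboundary : ((V → ℂ) ⧸ G.L) →ₗ[ℂ] (E → ℂ) := LinearMap.pi G.edgeDiff

theorem coboundary_mk (x : V → ℂ) (e : E) :
    G.coboundary (Submodule.Quotient.mk x) e = x (G.ends e).inf - x (G.ends e).sup := rfl

/-- Vanishing edge differences make a function constant along walks, and such functions lie in
`L_G`. -/
theorem coboundary_injective [Finite V] : Function.Injective G.coboundary := by
  rw [injective_iff_map_eq_zero]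
  intro q hq
  obtain ⟨x, rfl⟩ := Submodule.Quotient.mk_surjective _ q
  rw [Submodule.Quotient.mk_eq_zero]
  refine G.mem_L_of_sameComponent fun u v huv => ?_
  obtain ⟨w⟩ := huv
  induction w with
  | nil => rfl
  | cons h _ ih =>
    rw [← ih]
    rw [skeleton, SimpleGraph.fromEdgeSet_adj] at h
    obtain ⟨⟨e, -, he⟩, -⟩ := h
    have := congrFun hq e
    rw [coboundary_mk, Pi.zero_apply, sub_eq_zero] at this
    rw [← Sym2.mk_inf_sup (G.ends e), Sym2.eq_iff] at he
    rcases he with ⟨rfl, rfl⟩ | ⟨rfl, rfl⟩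
    · exact this
    · exact this.symm

/-- The space of the vectors of differences of vertex functions along the edges. -/
noncomputable def cutSpace : Submodule ℂ (E → ℂ) := LinearMap.range G.coboundary

theorem mem_cutSpace {a : E → ℂ} :
    a ∈ G.cutSpace ↔ ∃ x : V → ℂ, ∀ e, a e = x (G.ends e).inf - x (G.ends e).sup := by
  constructor
  · rintro ⟨q, rfl⟩
    obtain ⟨x, rfl⟩ := Submodule.Quotient.mk_surjective _ q
    exact ⟨x, fun e => rfl⟩
  · rintro ⟨x, hx⟩
    exact ⟨Submodule.Quotient.mk x, funext fun e => (hx e).symm⟩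

/-- The cut space does not depend on the chosen vertex set: functions on it extend by zero. Dropping
isolated vertices in `B₁` and `B₂` is therefore harmless. -/
theorem mem_cutSpace_subgraph {A : Set V} {F : Set E} {h : ∀ e ∈ F, ∀ v ∈ G.ends e, v ∈ A}
    {a : F → ℂ} : a ∈ (G.subgraph A F h).cutSpace ↔
      ∃ x : V → ℂ, ∀ e : F, a e = x (G.ends e).inf - x (G.ends e).sup := by
  rw [mem_cutSpace]
  constructor
  · rintro ⟨x, hx⟩
    classical
    refine ⟨fun v => if hv : v ∈ A then x ⟨v, hv⟩ else 0, fun e => ?_⟩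
    rw [hx]
    dsimp only
    rw [dif_pos (h e e.2 _ (G.inf_mem_ends e)), dif_pos (h e e.2 _ (G.sup_mem_ends e))]
    congr 2
    · exact Subtype.ext (Sym2.attachWith_inf_coe _ _)
    · exact Subtype.ext (Sym2.attachWith_sup_coe _ _)
  · rintro ⟨x, hx⟩
    refine ⟨fun v => x v, fun e => ?_⟩
    rw [hx]
    congr 2
    · exact (Sym2.attachWith_inf_coe _ _).symm
    · exact (Sym2.attachWith_sup_coe _ _).symm

/-- Along a walk that starts in a part `A` of the graph, differences of vertex functions are linear
combinations of the differences along the edges in that part. -/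
theorem exists_difference_form {A : Set V} {F F' : Set E}
    (hF : ∀ e ∈ F, ∀ v ∈ G.ends e, v ∈ A) (hF' : ∀ e ∈ F', ∀ v ∈ G.ends e, v ∉ A) {u v : V}
    (hu : u ∈ A) (huv : (G.skeleton (F ∪ F')).Reachable u v) :
    ∃ l : (F → ℂ) →ₗ[ℂ] ℂ, ∀ x : V → ℂ,
      l (fun e => x (G.ends e).inf - x (G.ends e).sup) = x u - x v := by
  obtain ⟨w⟩ := huv
  induction w with
  | nil => exact ⟨0, by simp⟩
  | @cons u v _ h _ ih =>
    rw [skeleton, SimpleGraph.fromEdgeSet_adj] at h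
    obtain ⟨⟨e, he, hee⟩, -⟩ := h
    have hue : u ∈ G.ends e := hee ▸ Sym2.mem_mk_left _ _
    have hve : v ∈ G.ends e := hee ▸ Sym2.mem_mk_right _ _
    have he : e ∈ F := he.resolve_right fun h => hF' e h u hue hu
    obtain ⟨l, hl⟩ := ih (hF e he v hve)
    rw [← Sym2.mk_inf_sup (G.ends e), Sym2.eq_iff] at hee
    rcases hee with ⟨rfl, rfl⟩ | ⟨rfl, rfl⟩
    · refine ⟨l + LinearMap.proj ⟨e, he⟩, fun x => ?_⟩
      simp [hl]
    · refine ⟨l - LinearMap.proj ⟨e, he⟩, fun x => ?_⟩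
      simp [hl]

/-- If `G` is a disjoint union of graphs with edge sets `F ∪ {e₀}` and `F'`, and `e₀` is neither a
bridge nor a self-loop, the cut space of `G` is determined by those of `F` and `F'`, the coordinate
at `e₀` being a nonzero linear form on the former. -/
theorem exists_cutSpace_form [Finite V] {A A' : Set V} (hA : Disjoint A A') {F F' : Set E} {e₀ : E}
    (hcover : F ∪ F' ∪ {e₀} = Set.univ) (hF : ∀ e ∈ F ∪ {e₀}, ∀ v ∈ G.ends e, v ∈ A)
    (hF' : ∀ e ∈ F', ∀ v ∈ G.ends e, v ∈ A') (hloop : ¬ (G.ends e₀).IsDiag)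
    (hbridge : ¬ G.IsBridge e₀) {D : Set V}
    (hFD : ∀ e ∈ F, ∀ v ∈ G.ends e, v ∈ D) :
    ∃ l : (F → ℂ) →ₗ[ℂ] ℂ, (∃ a ∈ (G.subgraph D F hFD).cutSpace, l a ≠ 0) ∧
      ∀ a : E → ℂ, a ∈ G.cutSpace ↔ (fun e : F => a e) ∈ (G.subgraph D F hFD).cutSpace ∧
        (fun e : F' => a e) ∈ (G.subgraph A' F' hF').cutSpace ∧ a e₀ = l fun e => a e := by
  classical
  have hreach : (G.skeleton (F ∪ F')).Reachable (G.ends e₀).inf (G.ends e₀).sup := by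
    refine (G.reachable_of_not_isBridge hbridge (G.sameComponent_inf_sup e₀)).mono ?_
    refine SimpleGraph.fromEdgeSet_mono (Set.image_mono fun e he => ?_)
    exact (hcover.ge (Set.mem_univ e)).resolve_right he
  have hinf : (G.ends e₀).inf ∈ A := hF e₀ (Or.inr rfl) _ (G.inf_mem_ends e₀)
  have hsup : (G.ends e₀).sup ∈ A := hF e₀ (Or.inr rfl) _ (G.sup_mem_ends e₀)
  obtain ⟨l, hl⟩ := G.exists_difference_form (fun e he => hF e (Or.inl he))
    (fun e he v hv => Set.disjoint_right.1 hA (hF' e he v hv)) hinf hreach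
  -- The indicator function of one endpoint of `e₀` has difference `1` along `e₀`, which is not a
  -- loop, so `l` takes the value `1`.
  refine ⟨l, ⟨_, G.mem_cutSpace_subgraph.2
    ⟨Pi.single (G.ends e₀).inf 1, fun e => rfl⟩, ?_⟩, fun a => ?_⟩
  · rw [hl]
    simp [(Sym2.inf_ne_sup hloop).symm]
  rw [mem_cutSpace_subgraph, mem_cutSpace_subgraph, mem_cutSpace]
  constructor
  · rintro ⟨x, hx⟩
    refine ⟨⟨x, fun e => hx e⟩, ⟨x, fun e => hx e⟩, ?_⟩
    simp only [hx]
    exact (hl x).symm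
  · rintro ⟨⟨x, hx⟩, ⟨y, hy⟩, h0⟩
    refine ⟨fun v => if v ∈ A then x v else y v, fun e => ?_⟩
    rcases hcover.ge (Set.mem_univ e) with (he | he) | rfl
    · simp only [hF e (Or.inl he) _ (G.inf_mem_ends e), hF e (Or.inl he) _ (G.sup_mem_ends e),
        if_true]
      exact hx ⟨e, he⟩
    · simp only [Set.disjoint_right.1 hA (hF' e he _ (G.inf_mem_ends e)),
        Set.disjoint_right.1 hA (hF' e he _ (G.sup_mem_ends e)), if_false]
      exact hy ⟨e, he⟩
    · simp only [hinf, hsup, if_true, h0, hx]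
      exact hl x

end Multigraph

/-! ### Zariski open sets and nonvanishing of polynomials -/

theorem MvPolynomial.IsHomogeneous.eval_smul {σ R : Type*} [CommSemiring R] {f : MvPolynomial σ R}
    {d : ℕ} (hf : f.IsHomogeneous d) (t : R) (z : σ → R) :
    MvPolynomial.eval (t • z) f = t ^ d * MvPolynomial.eval z f := by
  rw [MvPolynomial.eval_eq, MvPolynomial.eval_eq, Finset.mul_sum]
  refine Finset.sum_congr rfl fun m hm => ?_
  simp only [Pi.smul_apply, smul_eq_mul, mul_pow]
  rw [Finset.prod_mul_distrib, Finset.prod_pow_eq_pow_sum, hf.degree_eq_sum_deg_support hm]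
  ring

theorem Projectivization.eq_of_smul_rep_eq {k M : Type*} [Field k] [AddCommGroup M] [Module k M]
    {p p' : ℙ k M} {c c' : k} (hc : c ≠ 0) (h : c • p.rep = c' • p'.rep) : p = p' := by
  rw [← p.mk_rep, ← p'.mk_rep, Projectivization.mk_eq_mk_iff']
  refine ⟨c⁻¹ * c', ?_⟩
  rw [mul_smul, ← h, smul_smul, inv_mul_cancel₀ hc, one_smul]

theorem exists_eval_ne_zero {E : Type*} [Nonempty E] {g : MvPolynomial E ℂ} (hg : g ≠ 0) :
    ∃ z : E → ℂ, z ≠ 0 ∧ MvPolynomial.eval z g ≠ 0 := by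
  obtain ⟨e⟩ := ‹Nonempty E›
  by_contra! h
  refine mul_ne_zero hg (MvPolynomial.X_ne_zero (R := ℂ) e) (MvPolynomial.funext fun z => ?_)
  rw [map_mul, map_zero, MvPolynomial.eval_X]
  by_cases hz : z = 0
  · simp [hz]
  · rw [h z hz, zero_mul]

theorem IsZariskiOpen.exists_polynomial {E : Type*} {U : Set (ℙ ℂ (E → ℂ))} (hU : IsZariskiOpen U)
    (hne : U.Nonempty) : ∃ g : MvPolynomial E ℂ, g ≠ 0 ∧
      ∀ (z : E → ℂ) (hz : z ≠ 0), MvPolynomial.eval z g ≠ 0 → Projectivization.mk ℂ z hz ∈ U := by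
  obtain ⟨I, -, hI⟩ := hU
  obtain ⟨p, hp⟩ := hne
  induction p using Projectivization.ind with
  | h z hz =>
    have := (hI z hz).not.1 fun h => h hp
    push Not at this
    obtain ⟨g, hg, hgz⟩ := this
    refine ⟨g, by rintro rfl; simp at hgz, fun y hy hgy => ?_⟩
    by_contra hyU
    exact hgy ((hI y hy).1 hyU g hg)

/-- Nonempty Zariski open sets intersect. -/
theorem IsZariskiOpen.inter_nonempty {E : Type*} [Nonempty E] {U U' : Set (ℙ ℂ (E → ℂ))}
    (hU : IsZariskiOpen U) (hU' : IsZariskiOpen U') (hne : U.Nonempty) (hne' : U'.Nonempty) :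
    (U ∩ U').Nonempty := by
  obtain ⟨g, hg, h⟩ := hU.exists_polynomial hne
  obtain ⟨g', hg', h'⟩ := hU'.exists_polynomial hne'
  obtain ⟨z, hz, hgz⟩ := exists_eval_ne_zero (mul_ne_zero hg hg')
  rw [map_mul, mul_ne_zero_iff] at hgz
  exact ⟨_, h z hz hgz.1, h' z hz hgz.2⟩

/-- The points all of whose multiples are zeros of `g` are the common zeros of the homogeneous
components of `g`; they form a Zariski closed set. -/
theorem exists_isZariskiOpen_of_polynomial {E : Type*} [Nonempty E] {g : MvPolynomial E ℂ}
    (hg : g ≠ 0) : ∃ U : Set (ℙ ℂ (E → ℂ)), IsZariskiOpen U ∧ U.Nonempty ∧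
      ∀ (z : E → ℂ) (hz : z ≠ 0), Projectivization.mk ℂ z hz ∈ U →
        ∃ t : ℂ, t ≠ 0 ∧ MvPolynomial.eval (t • z) g ≠ 0 := by
  have hsmul : ∀ (t : ℂ) (z : E → ℂ) (d : ℕ),
      MvPolynomial.eval (t • z) (MvPolynomial.homogeneousComponent d g) =
        t ^ d * MvPolynomial.eval z (MvPolynomial.homogeneousComponent d g) := fun t z d =>
    (MvPolynomial.homogeneousComponent_isHomogeneous d g).eval_smul t z
  let U : Set (ℙ ℂ (E → ℂ)) :=
    {p | ∃ d, MvPolynomial.eval p.rep (MvPolynomial.homogeneousComponent d g) ≠ 0}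
  have hU : ∀ (z : E → ℂ) (hz : z ≠ 0), Projectivization.mk ℂ z hz ∈ U ↔
      ∃ d, MvPolynomial.eval z (MvPolynomial.homogeneousComponent d g) ≠ 0 := by
    intro z hz
    obtain ⟨a, ha⟩ := Projectivization.exists_smul_eq_mk_rep ℂ z hz
    refine exists_congr fun d => ?_
    rw [← ha, Units.smul_def, hsmul, mul_ne_zero_iff, and_iff_right (pow_ne_zero _ a.ne_zero)]
  have heval : ∀ z : E → ℂ, MvPolynomial.eval z g = ∑ d ∈ Finset.range (g.totalDegree + 1),
      MvPolynomial.eval z (MvPolynomial.homogeneousComponent d g) := fun z => by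
    rw [← map_sum, MvPolynomial.sum_homogeneousComponent]
  refine ⟨U, ⟨Set.range fun d => MvPolynomial.homogeneousComponent d g, ?_, fun z hz => ?_⟩, ?_,
    fun z hz hzU => ?_⟩
  · rintro _ ⟨d, rfl⟩
    exact ⟨d, MvPolynomial.homogeneousComponent_isHomogeneous d g⟩
  · rw [Set.mem_compl_iff, hU]
    simp
  · obtain ⟨z, hz, hgz⟩ := exists_eval_ne_zero hg
    rw [heval] at hgz
    obtain ⟨d, -, hd⟩ := Finset.exists_ne_zero_of_sum_ne_zero hgz
    exact ⟨_, (hU z hz).2 ⟨d, hd⟩⟩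
  · obtain ⟨d, hd⟩ := (hU z hz).1 hzU
    by_contra! h
    -- The restriction of `g` to the line through `z`, whose coefficients are the values at `z` of
    -- the homogeneous components.
    let q : Polynomial ℂ := ∑ d ∈ Finset.range (g.totalDegree + 1),
      Polynomial.monomial d (MvPolynomial.eval z (MvPolynomial.homogeneousComponent d g))
    have hq : ∀ t, q.eval t = MvPolynomial.eval (t • z) g := by
      intro t
      simp only [q, heval, hsmul, Polynomial.eval_finsetSum, Polynomial.eval_monomial, mul_comm]
    have hq0 : q * Polynomial.X = 0 := by
      refine Polynomial.funext fun t => ?_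
      rw [Polynomial.eval_mul, Polynomial.eval_X, Polynomial.eval_zero, hq]
      by_cases ht : t = 0
      · rw [ht, mul_zero]
      · rw [h t ht, zero_mul]
    have hq0 : q = 0 := (mul_eq_zero.1 hq0).resolve_right Polynomial.X_ne_zero
    have hd' : d ∈ Finset.range (g.totalDegree + 1) := by
      by_contra hlt
      refine hd ?_
      rw [MvPolynomial.homogeneousComponent_eq_zero _ _ (by simpa using hlt), map_zero]
    have := congrArg (fun q => q.coeff d) hq0
    simp only [q, Polynomial.finsetSum_coeff, Polynomial.coeff_monomial, Polynomial.coeff_zero,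
      Finset.sum_ite_eq', hd', if_true] at this
    exact hd this

/-! ### The Laman number as a count of normalized pairs -/

namespace Bigraph

variable {V W E : Type*} [LinearOrder V] [LinearOrder W] (B : Bigraph V W E)

theorem lam_eq_of_isZariskiOpen [Nonempty E] {n : ℕ∞} {U : Set (ℙ ℂ (E → ℂ))}
    (hU : IsZariskiOpen U) (hne : U.Nonempty) (h : ∀ p ∈ U, (B.fiber p).encard = n) :
    B.lam = n := by
  rw [lam]
  split_ifs with hd
  · have : {n : ℕ∞ | ∃ U : Set (ℙ ℂ (E → ℂ)), IsZariskiOpen U ∧ U.Nonempty ∧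
        ∀ p ∈ U, (B.fiber p).encard = n} = {n} := by
      refine Set.eq_singleton_iff_unique_mem.2 ⟨⟨U, hU, hne, h⟩, ?_⟩
      rintro m ⟨U', hU', hne', h'⟩
      obtain ⟨p, hp, hp'⟩ := hU.inter_nonempty hU' hne hne'
      rw [← h p hp, h' p hp']
    rw [degree, this, sSup_singleton]
  -- If `n ≠ 0`, the fibres over `U` are nonempty, and `U` meets every nonempty open set, so the map
  -- would be dominant.
  · by_contra hn
    refine hd fun U' hU' hne' => ?_
    obtain ⟨p, hp, hp'⟩ := hU.inter_nonempty hU' hne hne'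
    refine ⟨p, ?_, hp'⟩
    rw [Set.mem_ofPred_eq, ← Set.encard_ne_zero, h p hp]
    exact Ne.symm hn

/-- The polynomial `g` need not be homogeneous: the fibre depends only on the line through `z`, so
one multiple of `z` outside the zeros of `g` suffices. -/
theorem lam_eq_of_polynomial [Nonempty E] {n : ℕ∞} {g : MvPolynomial E ℂ} (hg : g ≠ 0)
    (h : ∀ (z : E → ℂ) (hz : z ≠ 0), MvPolynomial.eval z g ≠ 0 →
      (B.fiber (Projectivization.mk ℂ z hz)).encard = n) : B.lam = n := by
  obtain ⟨U, hU, hne, hUg⟩ := exists_isZariskiOpen_of_polynomial hg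
  refine B.lam_eq_of_isZariskiOpen hU hne fun p hp => ?_
  induction p using Projectivization.ind with
  | h z hz =>
    obtain ⟨t, ht, hgt⟩ := hUg z hz hp
    rw [← h _ (smul_ne_zero ht hz) hgt]
    congr 2
    exact (Projectivization.mk_eq_mk_iff' ℂ _ _ _ _).2
      ⟨t⁻¹, by rw [smul_smul, inv_mul_cancel₀ ht, one_smul]⟩

theorem edgeVector_eq (x : (V → ℂ) ⧸ B.G.L) (y : (W → ℂ) ⧸ B.H.L) :
    B.edgeVector x y = B.G.coboundary x * B.H.coboundary y := rfl

theorem mem_fiber_mk {z : E → ℂ} (hz : z ≠ 0) (q : B.G.Space × B.H.Space) :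
    q ∈ B.fiber (Projectivization.mk ℂ z hz) ↔
      ∃ c : ℂ, c ≠ 0 ∧ B.G.coboundary q.1.rep * B.H.coboundary q.2.rep = c • z := by
  have := B.mem_ratMap_mk q.1.rep q.1.rep_nonzero q.2.rep q.2.rep_nonzero z hz
  rw [Projectivization.mk_rep, Projectivization.mk_rep, edgeVector_eq] at this
  refine this.trans ⟨?_, ?_⟩
  · rintro ⟨c, hc⟩
    exact ⟨c, c.ne_zero, hc.symm⟩
  · rintro ⟨c, hc0, hc⟩
    exact ⟨Units.mk0 c hc0, hc.symm⟩

/-- The points of a fibre of `f_B` are given by the normalized pairs of vectors of the cut spaces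
with the prescribed product. -/
theorem encard_fiber_mk [Finite V] [Finite W] {z : E → ℂ} (hz : z ≠ 0) {e : E} (he : z e ≠ 0) :
    (B.fiber (Projectivization.mk ℂ z hz)).encard =
      (normalizedPairs B.G.cutSpace B.H.cutSpace (LinearMap.proj e) z).encard := by
  have hne : ∀ q ∈ B.fiber (Projectivization.mk ℂ z hz),
      B.G.coboundary q.1.rep e ≠ 0 ∧ B.H.coboundary q.2.rep e ≠ 0 := by
    intro q hq
    obtain ⟨c, hc, h⟩ := (B.mem_fiber_mk hz q).1 hq
    have := congrFun h e
    rw [← mul_ne_zero_iff, ← Pi.mul_apply, this]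
    exact mul_ne_zero hc he
  -- The first vector is scaled to have value `1` at `e`; the product then forces the value `z e`
  -- for the second.
  refine Set.encard_congr (Set.BijOn.equiv (fun q =>
    ((B.G.coboundary q.1.rep e)⁻¹ • B.G.coboundary q.1.rep,
      (z e * (B.H.coboundary q.2.rep e)⁻¹) • B.H.coboundary q.2.rep)) ⟨?_, ?_, ?_⟩)
  · intro q hq
    obtain ⟨h1, h2⟩ := hne q hq
    refine ⟨Submodule.smul_mem _ _ ⟨_, rfl⟩, Submodule.smul_mem _ _ ⟨_, rfl⟩, by simp [h1], ?_⟩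
    obtain ⟨c, hc, h⟩ := (B.mem_fiber_mk hz q).1 hq
    have hce : B.G.coboundary q.1.rep e * B.H.coboundary q.2.rep e = c * z e := congrFun h e
    dsimp only
    rw [smul_mul_smul_comm, h, smul_smul]
    refine (congrArg (· • z) ?_).trans (one_smul _ _)
    field_simp
    rw [hce]
    ring
  · rintro q hq q' hq' h
    obtain ⟨h1, h2⟩ := hne q hq
    obtain ⟨h1', h2'⟩ := hne q' hq'
    simp only [Prod.mk.injEq, ← map_smul] at h
    exact Prod.ext
      (Projectivization.eq_of_smul_rep_eq (inv_ne_zero h1) (B.G.coboundary_injective h.1))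
      (Projectivization.eq_of_smul_rep_eq (mul_ne_zero he (inv_ne_zero h2))
        (B.H.coboundary_injective h.2))
  · rintro ⟨_, _⟩ ⟨⟨x, rfl⟩, ⟨y, rfl⟩, hxe, hxy⟩
    simp only [LinearMap.proj_apply] at hxe hxy
    have hx : x ≠ 0 := by
      rintro rfl
      simp at hxe
    have hy : y ≠ 0 := by
      rintro rfl
      exact hz (by rw [← hxy, map_zero, mul_zero])
    have hye : B.H.coboundary y e = z e := by
      rw [← hxy, Pi.mul_apply, hxe, one_mul]
    obtain ⟨s, hs⟩ := Projectivization.exists_smul_eq_mk_rep ℂ x hx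
    obtain ⟨t, ht⟩ := Projectivization.exists_smul_eq_mk_rep ℂ y hy
    refine ⟨(Projectivization.mk ℂ x hx, Projectivization.mk ℂ y hy),
      (B.mem_fiber_mk hz _).2 ⟨s * t, mul_ne_zero s.ne_zero t.ne_zero, ?_⟩, ?_⟩
    · rw [← hs, ← ht, Units.smul_def, Units.smul_def, map_smul, map_smul, smul_mul_smul_comm, hxy]
    · simp only [← hs, ← ht, Units.smul_def, map_smul, Pi.smul_apply, smul_eq_mul, hxe, hye,
        smul_smul, Prod.mk.injEq]
      refine ⟨?_, ?_⟩
      · simp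
      · refine (congrArg (· • B.H.coboundary y) ?_).trans (one_smul _ _)
        field_simp [t.ne_zero]

end Bigraph

/-! ### Gluing at the untangling biedge -/

/-- If both spaces are glued from two parts along a coordinate `e₀` that is a linear form on the
first part in one of them and on the second part in the other, the product fibres are products. -/
theorem encard_normalizedPairs_glue {k E : Type*} [Field k] {E₁ E₂ : Set E} {e₀ : E}
    (hcover : E₁ ∪ E₂ ∪ {e₀} = Set.univ) (hdisj : Disjoint E₁ E₂) (h₁ : e₀ ∉ E₁) (h₂ : e₀ ∉ E₂)
    {A B : Submodule k (E → k)} {A₁ B₁ : Submodule k (E₁ → k)} {A₂ B₂ : Submodule k (E₂ → k)}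
    {l : (E₁ → k) →ₗ[k] k} {m : (E₂ → k) →ₗ[k] k}
    (hA : ∀ a : E → k, a ∈ A ↔ (fun e : E₁ => a e) ∈ A₁ ∧ (fun e : E₂ => a e) ∈ A₂ ∧
      a e₀ = l fun e => a e)
    (hB : ∀ b : E → k, b ∈ B ↔ (fun e : E₂ => b e) ∈ B₂ ∧ (fun e : E₁ => b e) ∈ B₁ ∧
      b e₀ = m fun e => b e) {z : E → k} (hz : z e₀ ≠ 0) :
    (normalizedPairs A B (LinearMap.proj e₀) z).encard =
      (normalizedPairs A₁ B₁ l fun e => z e).encard *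
        (normalizedPairs B₂ A₂ m fun e => z e).encard := by
  classical
  rw [← Set.encard_prod]
  have hb₀ : ∀ {a b : E → k}, a e₀ = 1 → a * b = z → b e₀ = z e₀ := by
    intro a b h1 h2
    rw [← h2, Pi.mul_apply, h1, one_mul]
  have hext : ∀ {a a' : E → k}, (∀ e : E₁, a e = a' e) → (∀ e : E₂, a e = a' e) → a e₀ = a' e₀ →
      a = a' := by
    intro a a' g1 g2 g0
    funext e
    rcases hcover.ge (Set.mem_univ e) with (he | he) | rfl
    · exact g1 ⟨e, he⟩
    · exact g2 ⟨e, he⟩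
    · exact g0
  have hglue : ∀ (a₁ : E₁ → k) (a₂ : E₂ → k) (a₀ : k), ∃ a : E → k,
      (fun e : E₁ => a e) = a₁ ∧ (fun e : E₂ => a e) = a₂ ∧ a e₀ = a₀ := by
    intro a₁ a₂ a₀
    refine ⟨fun e => if h : e ∈ E₁ then a₁ ⟨e, h⟩ else if h : e ∈ E₂ then a₂ ⟨e, h⟩ else a₀,
      funext fun e => ?_, funext fun e => ?_, ?_⟩
    · simp
    · simp [Set.disjoint_right.1 hdisj e.2]
    · simp [h₁, h₂]
  -- On `E₂` the roles of the factors are exchanged: `m` takes the value `b e₀ = z e₀` on `b`, so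
  -- `b` is divided by `z e₀` and `a` multiplied by it.
  refine Set.encard_congr (Set.BijOn.equiv (fun p =>
    ((fun e : E₁ => p.1 e, fun e : E₁ => p.2 e),
      ((z e₀)⁻¹ • (fun e : E₂ => p.2 e), z e₀ • fun e : E₂ => p.1 e))) ⟨?_, ?_, ?_⟩)
  · rintro ⟨a, b⟩ ⟨ha, hb, hae, hab⟩
    obtain ⟨ha₁, ha₂, ha₀⟩ := (hA a).1 ha
    obtain ⟨hb₂, hb₁, hb₀'⟩ := (hB b).1 hb
    simp only [LinearMap.proj_apply] at hae hab
    refine ⟨⟨ha₁, hb₁, ha₀.symm.trans hae, funext fun e => congrFun hab e⟩,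
      ⟨B₂.smul_mem _ hb₂, A₂.smul_mem _ ha₂, ?_, ?_⟩⟩
    · rw [map_smul, ← hb₀', hb₀ hae hab, smul_eq_mul, inv_mul_cancel₀ hz]
    · dsimp only
      rw [smul_mul_smul_comm, inv_mul_cancel₀ hz, one_smul, mul_comm]
      exact funext fun e => congrFun hab e
  · rintro ⟨a, b⟩ ⟨-, -, hae, hab⟩ ⟨a', b'⟩ ⟨-, -, hae', hab'⟩ h
    simp only [LinearMap.proj_apply] at hae hab hae' hab'
    simp only [Prod.mk.injEq] at h ⊢
    obtain ⟨⟨g1, g2⟩, g3, g4⟩ := h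
    have g3 := smul_right_injective _ (inv_ne_zero hz) g3
    have g4 := smul_right_injective _ hz g4
    exact ⟨hext (fun e => congrFun g1 e) (fun e => congrFun g4 e) (hae.trans hae'.symm),
      hext (fun e => congrFun g2 e) (fun e => congrFun g3 e)
        ((hb₀ hae hab).trans (hb₀ hae' hab').symm)⟩
  · rintro ⟨⟨a₁, b₁⟩, ⟨b₂, a₂⟩⟩ ⟨⟨ha₁, hb₁, hl, hz₁⟩, ⟨hb₂, ha₂, hm, hz₂⟩⟩
    simp only at ha₁ hb₁ hl hz₁ ha₂ hb₂ hm hz₂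
    obtain ⟨a, rfl, haa, ha0⟩ := hglue a₁ ((z e₀)⁻¹ • a₂) 1
    obtain ⟨b, rfl, hbb, hb0⟩ := hglue b₁ (z e₀ • b₂) (z e₀)
    refine ⟨(a, b), ⟨(hA a).2 ⟨ha₁, ?_, ?_⟩, (hB b).2 ⟨?_, hb₁, ?_⟩, ha0, ?_⟩, ?_⟩
    · rw [haa]
      exact A₂.smul_mem _ ha₂
    · rw [ha0, hl]
    · rw [hbb]
      exact B₂.smul_mem _ hb₂
    · rw [hb0, hbb, map_smul, hm, smul_eq_mul, mul_one]
    · refine hext (fun e => congrFun hz₁ e) (fun e => ?_) ?_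
      · have g1 := congrFun haa e
        have g2 := congrFun hbb e
        have g3 := congrFun hz₂ e
        simp only [Pi.smul_apply, smul_eq_mul, Pi.mul_apply] at g1 g2 g3 ⊢
        rw [g1, g2, ← g3]
        field_simp
      · simp only [Pi.mul_apply, ha0, hb0, one_mul]
    · simp only [haa, hbb, smul_smul, inv_mul_cancel₀ hz, mul_inv_cancel₀ hz, one_smul]

open MvPolynomial in
theorem eval_rename_subtype {k E : Type*} [CommSemiring k] {F : Set E} (z : E → k)
    (g : MvPolynomial F k) :
    eval z (rename (Subtype.val : F → E) g) = eval (fun e : F => z e) g :=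
  eval_rename _ _ _

theorem proposition2p16 {V W E : Type*} [Finite V] [Finite W] [Finite E]
    [LinearOrder V] [LinearOrder W] (B : Bigraph V W E) (hB : B.NoSelfLoops)
    (e₀ : E) (V₁ V₂ : Set V) (W₁ W₂ : Set W) (E₁ E₂ : Set E)
    (h : B.UntanglesVia e₀ V₁ V₂ W₁ W₂ E₁ E₂)
    (hG : ¬ B.G.IsBridge e₀) (hH : ¬ B.H.IsBridge e₀) :
    B.lam = h.left.lam * h.right.lam := by
  obtain ⟨l, hl, hA⟩ := B.G.exists_cutSpace_form h.isCompl_V.disjoint h.cover_E h.G_left h.G_right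
    (hB.1 e₀) hG (D := B.G.endpoints E₁) fun e he _ hv => ⟨e, he, hv⟩
  obtain ⟨m, hm, hA'⟩ := B.H.exists_cutSpace_form h.isCompl_W.disjoint.symm
    (by rw [Set.union_comm E₂, h.cover_E]) h.H_right h.H_left
    (hB.2 e₀) hH (D := B.H.endpoints E₂) fun e he _ hv => ⟨e, he, hv⟩
  have hne : ∀ {F : Set E} {l : (F → ℂ) →ₗ[ℂ] ℂ} {A : Submodule ℂ (F → ℂ)},
      (∃ a ∈ A, l a ≠ 0) → Nonempty F := by
    rintro F l A ⟨a, -, ha⟩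
    by_contra hF
    rw [not_nonempty_iff] at hF
    exact ha (by rw [Subsingleton.elim a 0, map_zero])
  have hne₁ := hne hl
  have hne₂ := hne hm
  obtain ⟨e₁⟩ := id hne₁
  obtain ⟨e₂⟩ := id hne₂
  have : Nonempty E := ⟨e₀⟩
  obtain ⟨n₁, g₁, hg₁, hn₁⟩ :=
    exists_encard_normalizedPairs _ (B.H.subgraph W₁ E₁ h.H_left).cutSpace l hl e₁
  obtain ⟨n₂, g₂, hg₂, hn₂⟩ :=
    exists_encard_normalizedPairs _ (B.G.subgraph V₂ E₂ h.G_right).cutSpace m hm e₂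
  have hleft : h.left.lam = n₁ := by
    refine h.left.lam_eq_of_polynomial (mul_ne_zero hg₁ (MvPolynomial.X_ne_zero e₁))
      fun z hz hgz => ?_
    rw [map_mul, MvPolynomial.eval_X, mul_ne_zero_iff] at hgz
    rw [Bigraph.encard_fiber_mk _ hz hgz.2]
    exact (hn₁ z hgz.1).1
  have hright : h.right.lam = n₂ := by
    refine h.right.lam_eq_of_polynomial (mul_ne_zero hg₂ (MvPolynomial.X_ne_zero e₂))
      fun z hz hgz => ?_
    rw [map_mul, MvPolynomial.eval_X, mul_ne_zero_iff] at hgz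
    -- The form `m` lives on the cut space from `H`, so the normalization is moved to the second
    -- factor.
    rw [Bigraph.encard_fiber_mk _ hz hgz.2, encard_normalizedPairs_swap _ _ _ hgz.2]
    exact (hn₂ z hgz.1).1
  have hrename : ∀ {F : Set E} {g : MvPolynomial F ℂ}, g ≠ 0 →
      MvPolynomial.rename (Subtype.val : F → E) g ≠ 0 := fun hg =>
    (map_ne_zero_iff _ (MvPolynomial.rename_injective _ Subtype.val_injective)).2 hg
  rw [hleft, hright]
  -- A general `z` restricts to general vectors on `E₁` and `E₂`, with `z e₀ ≠ 0` for the gluing.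
  refine B.lam_eq_of_polynomial (mul_ne_zero (mul_ne_zero (hrename hg₁) (hrename hg₂))
    (MvPolynomial.X_ne_zero e₀)) fun z hz hgz => ?_
  rw [map_mul, map_mul, MvPolynomial.eval_X, mul_ne_zero_iff, mul_ne_zero_iff,
    eval_rename_subtype, eval_rename_subtype] at hgz
  rw [B.encard_fiber_mk hz hgz.2, encard_normalizedPairs_glue h.cover_E h.disjoint_E h.notMem_left
    h.notMem_right hA hA' hgz.2, (hn₁ _ hgz.1.1).2, (hn₂ _ hgz.1.2).2]
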